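/- For a set $\mathcal F$ of forms (homogeneous polynomials, possibly of different degrees) in $\mathbb C[x_0,\dots,x_n]$, let $\operatorname{rk}_{\mathbb C}\mathcal F$ (the complex simultaneous Waring rank) be the least integer $r$ for which there are linear forms $L_1,\dots,L_r$ such that every $F\in\mathcal F$ can be written as $F=\sum_{j=1}^r\lambda_jL_j^{\deg F}$ with coefficients $\lambda_j\in\mathbb C$ depending on $F$; put $\operatorname{rk}_{\mathbb C}F=\operatorname{rk}_{\mathbb C}\{F\}$. **Proposition.** Let $n\ge 0$ and $c\ge 1$ be integers, and let $M_1=x_0^{c}x_1^{a_1}\cdots x_n^{a_n}$ and $M_2=x_0^{c}x_1^{b_1}\cdots x_n^{b_n}$ with $a_i\ge c$ and $b_i\ge c$ for $i=1,\dots,n$. Suppose that for every $i=1,\dots,n$ either $|a_i-b_i|\in\{0,1\}$ or $|a_i-b_i|\ge c+1$. Let $M_{12}=\gcd(M_1,M_2)$ be a greatest common divisor of $M_1$ and $M_2$ in $\mathbb C[x_0,\dots,x_n]$. Then the ranks below are all finite and $$\operatorname{rk}_{\mathbb C}\{M_1,M_2\}\le \operatorname{rk}_{\mathbb C}M_1+\operatorname{rk}_{\mathbb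 C}M_2-\operatorname{rk}_{\mathbb C}M_{12}.$$ -/

import Mathlib

open MvPolynomial

/-- The forms in `ℱ` (of possibly different degrees) have a common decomposition with `r` linear
forms: there are linear forms `L₁, …, L_r` such that every `F ∈ ℱ` is a linear combination of
`L₁ ^ d, …, L_r ^ d`, where `d = deg F`. -/
def HasSimultaneousWaringDecomposition {σ : Type*} (ℱ : Set (MvPolynomial σ ℂ)) (r : ℕ) : Prop :=
  ∃ L : Fin r → MvPolynomial σ ℂ, (∀ j, (L j).IsHomogeneous 1) ∧
    ∀ F ∈ ℱ, ∃ lam : Fin r → ℂ, F = ∑ j, C (lam j) * L j ^ F.totalDegree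

/-- The complex simultaneous Waring rank of a collection of forms: the minimal number of linear
forms in a common decomposition (`⊤` if there is no such decomposition). -/
noncomputable def simultaneousWaringRank {σ : Type*} (ℱ : Set (MvPolynomial σ ℂ)) : ℕ∞ :=
  ⨅ (r : ℕ) (_ : HasSimultaneousWaringDecomposition ℱ r), (r : ℕ∞)

/-- The complex Waring rank of a single form. -/
noncomputable def waringRank {σ : Type*} (F : MvPolynomial σ ℂ) : ℕ∞ :=
  simultaneousWaringRank {F}

/-- The monomial `x₀ ^ c * x₁ ^ a₁ * ⋯ * xₙ ^ aₙ` in `ℂ[x₀, …, xₙ]`. -/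
noncomputable def powerMonomial {n : ℕ} (c : ℕ) (a : Fin n → ℕ) : MvPolynomial (Fin (n + 1)) ℂ :=
  X 0 ^ c * ∏ i : Fin n, X i.succ ^ a i

/-- `D` is a greatest common divisor of `A` and `B` (it is unique up to units). -/
def IsGreatestCommonDivisor {R : Type*} [CommRing R] (D A B : R) : Prop :=
  D ∣ A ∧ D ∣ B ∧ ∀ E : R, E ∣ A → E ∣ B → E ∣ D

/-! Each monomial is a combination of powers of the forms `x₀ + p₁x₁ + ⋯ + pₙxₙ`, with `p` in a grid
of `∏ (aᵢ + 1)` points whose sides are sparse node sets (`exists_powerMonomial_eq_sum_grid`). The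
sides for `M₁` and `M₂` can be chosen nested in each coordinate (`exists_nested_sparseNodeSets`), so
the two grids meet in a grid that serves for the gcd. The union of the grids decomposes both
monomials, and inclusion-exclusion counts it. The grids for `M₁` and `M₂` have minimal size
(`prod_succ_le_of_hasSimultaneousWaringDecomposition`). For the gcd an upper bound on the rank
suffices, since it enters with a minus sign. -/

theorem exists_simultaneousWaringRank_eq {σ : Type*} {ℱ : Set (MvPolynomial σ ℂ)} {N : ℕ}
    (h : HasSimultaneousWaringDecomposition ℱ N) :
    ∃ r : ℕ, simultaneousWaringRank ℱ = r ∧ r ≤ N ∧ HasSimultaneousWaringDecomposition ℱ r := by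
  classical
  have hex : ∃ r, HasSimultaneousWaringDecomposition ℱ r := ⟨N, h⟩
  refine ⟨Nat.find hex, le_antisymm (iInf₂_le _ (Nat.find_spec hex)) ?_, Nat.find_min' hex h,
    Nat.find_spec hex⟩
  exact le_iInf₂ fun r hr => by exact_mod_cast Nat.find_min' hex hr

theorem HasSimultaneousWaringDecomposition.of_finset {σ ι : Type*} {ℱ : Set (MvPolynomial σ ℂ)}
    (P : Finset ι) (L : ι → MvPolynomial σ ℂ) (hL : ∀ p ∈ P, (L p).IsHomogeneous 1)
    (h : ∀ F ∈ ℱ, ∃ lam : ι → ℂ, F = ∑ p ∈ P, C (lam p) * L p ^ F.totalDegree) :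
    HasSimultaneousWaringDecomposition ℱ P.card := by
  refine ⟨fun j => L (P.equivFin.symm j), fun j => hL _ (P.equivFin.symm j).2, fun F hF => ?_⟩
  obtain ⟨lam, hlam⟩ := h F hF
  refine ⟨fun j => lam (P.equivFin.symm j), ?_⟩
  rw [Equiv.sum_comp P.equivFin.symm (fun p : P => C (lam p) * L p ^ F.totalDegree),
    Finset.sum_coe_sort P (fun p => C (lam p) * L p ^ F.totalDegree)]
  exact hlam

theorem HasSimultaneousWaringDecomposition.C_mul {σ : Type*} {F : MvPolynomial σ ℂ} {r : ℕ} {u : ℂ}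
    (hu : u ≠ 0) (h : HasSimultaneousWaringDecomposition {F} r) :
    HasSimultaneousWaringDecomposition {C u * F} r := by
  obtain ⟨L, hL, h⟩ := h
  obtain ⟨lam, hlam⟩ := h F rfl
  refine ⟨L, hL, fun G hG => ⟨fun j => u * lam j, ?_⟩⟩
  rw [Set.mem_singleton_iff.1 hG]
  have hdeg : (C u * F).totalDegree = F.totalDegree := by
    refine le_antisymm ?_ ?_
    · simpa using totalDegree_mul (C u) F
    · have := totalDegree_mul (C u⁻¹) (C u * F)
      rwa [← mul_assoc, ← MvPolynomial.C_mul, inv_mul_cancel₀ hu, C_1, one_mul, totalDegree_C, zero_add] at this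
  rw [hdeg]
  conv_lhs => rw [hlam, Finset.mul_sum]
  simp only [MvPolynomial.C_mul, mul_assoc]

theorem MvPolynomial.IsHomogeneous.eq_sum_smul_X {σ R : Type*} [Fintype σ] [CommSemiring R]
    {L : MvPolynomial σ R} (hL : L.IsHomogeneous 1) : ∃ p : σ → R, L = ∑ i, p i • X i := by
  rw [← mem_homogeneousSubmodule, homogeneousSubmodule_one_eq_span_X,
    Submodule.mem_span_range_iff_exists_fun] at hL
  obtain ⟨p, hp⟩ := hL
  exact ⟨p, hp.symm⟩

theorem MvPolynomial.isHomogeneous_sum_smul_X {σ R : Type*} [Fintype σ] [CommSemiring R]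
    (p : σ → R) : (∑ i, p i • X i : MvPolynomial σ R).IsHomogeneous 1 :=
  IsHomogeneous.sum _ _ _ fun i _ => by
    rw [smul_eq_C_mul]
    exact (isHomogeneous_X R i).C_mul (p i)

/-- Comparison of coefficients in a decomposition of a monomial as a combination of powers of
linear forms. -/
theorem monomial_eq_sum_pow_iff {σ ι : Type*} [Fintype σ] [DecidableEq σ] (P : Finset ι)
    (p : ι → σ → ℂ) (lam : ι → ℂ) (s : σ →₀ ℕ) :
    (monomial s 1 : MvPolynomial σ ℂ) =
        ∑ j ∈ P, C (lam j) * (∑ i, p j i • X i) ^ s.degree ↔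
      ∀ m : σ →₀ ℕ, m.degree = s.degree →
        (m.multinomial : ℂ) * ∑ j ∈ P, lam j * ∏ i, p j i ^ m i = if m = s then 1 else 0 := by
  have key (m : σ →₀ ℕ) : coeff m (∑ j ∈ P, C (lam j) * (∑ i, p j i • X i) ^ s.degree) =
      if m.degree = s.degree then (m.multinomial : ℂ) * ∑ j ∈ P, lam j * ∏ i, p j i ^ m i
        else 0 := by
    have hm : (m.sum fun _ k => k) = m.degree := rfl
    simp only [coeff_sum, coeff_C_mul, coeff_linearCombination_X_pow_of_fintype, hm,
      Finsupp.prod_fintype _ _ (fun _ => pow_zero _)]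
    split_ifs
    · rw [Finset.mul_sum]
      exact Finset.sum_congr rfl fun j _ => by ring
    · simp
  rw [MvPolynomial.ext_iff]
  refine forall_congr' fun m => ?_
  rw [key, coeff_monomial]
  by_cases h : m = s
  · simp [h, eq_comm]
  · simp only [h, Ne.symm h, if_false]
    split_ifs with h' <;> simp [h', eq_comm]

theorem Finsupp.multinomial_ne_zero {σ : Type*} (s : σ →₀ ℕ) : s.multinomial ≠ 0 :=
  (Nat.multinomial_pos s.support s).ne'

/-! ### Monomials, their exponents and their gcd. -/

/-- The exponent of `powerMonomial c a`. -/
noncomputable def powerExponent {n : ℕ} (c : ℕ) (a : Fin n → ℕ) : Fin (n + 1) →₀ ℕ :=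
  Finsupp.equivFunOnFinite.symm (Fin.cons c a)

@[simp] theorem powerExponent_zero {n : ℕ} (c : ℕ) (a : Fin n → ℕ) : powerExponent c a 0 = c := rfl

@[simp] theorem powerExponent_succ {n : ℕ} (c : ℕ) (a : Fin n → ℕ) (i : Fin n) :
    powerExponent c a i.succ = a i := rfl

theorem powerExponent_self {n : ℕ} (m : Fin (n + 1) →₀ ℕ) :
    powerExponent (m 0) (fun i => m i.succ) = m := by
  ext i
  refine Fin.cases ?_ (fun i => ?_) i <;> simp

theorem degree_powerExponent {n : ℕ} (c : ℕ) (a : Fin n → ℕ) :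
    (powerExponent c a).degree = c + ∑ i, a i := by
  rw [Finsupp.degree_eq_sum, Fin.sum_univ_succ]
  simp

theorem powerMonomial_eq_monomial {n : ℕ} (c : ℕ) (a : Fin n → ℕ) :
    powerMonomial c a = monomial (powerExponent c a) 1 := by
  rw [monomial_eq, Finsupp.prod_fintype _ _ (fun _ => pow_zero _), Fin.prod_univ_succ]
  simp [powerMonomial]

theorem totalDegree_powerMonomial {n : ℕ} (c : ℕ) (a : Fin n → ℕ) :
    (powerMonomial c a).totalDegree = (powerExponent c a).degree := by
  rw [powerMonomial_eq_monomial, totalDegree_monomial _ one_ne_zero]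
  rfl

theorem isGreatestCommonDivisor_powerMonomial {n c : ℕ} {a b : Fin n → ℕ}
    {D : MvPolynomial (Fin (n + 1)) ℂ}
    (hD : IsGreatestCommonDivisor D (powerMonomial c a) (powerMonomial c b)) :
    ∃ u : ℂ, u ≠ 0 ∧ D = C u * powerMonomial c (fun i => min (a i) (b i)) := by
  obtain ⟨hA, hB, hmax⟩ := hD
  simp only [powerMonomial_eq_monomial] at hA hB hmax
  obtain ⟨m, u, hma, hu, rfl⟩ := dvd_monomial_one_iff_exists.1 hA
  have hmb : m ≤ powerExponent c b := by
    simpa [hu.ne_zero] using (monomial_dvd_monomial.1 hB).1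
  refine ⟨u, hu.ne_zero, ?_⟩
  have h1 : monomial (powerExponent c fun i => min (a i) (b i)) (1 : ℂ) ∣ monomial m u := by
    refine hmax _ ?_ ?_
    all_goals
      refine monomial_dvd_monomial.2 ⟨Or.inr ?_, dvd_rfl⟩
      intro i
      refine Fin.cases ?_ (fun i => ?_) i <;> simp
  have h2 : m = powerExponent c fun i => min (a i) (b i) := by
    refine le_antisymm ?_ ?_
    · intro i
      have h3 := hma i
      have h4 := hmb i
      revert h3 h4
      refine Fin.cases ?_ (fun i => ?_) i <;> simp +contextual
    · rcases (monomial_dvd_monomial.1 h1).1 with h | h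
      · exact absurd h hu.ne_zero
      · exact h
  rw [powerMonomial_eq_monomial, C_mul_monomial, mul_one, h2]

/-! ### Upper bound: decompositions supported on grids. -/

/-- `S` consists of `a + 1` numbers and its nodal polynomial differs from `t ^ (a + 1)` by a
polynomial of degree at most `a - c`. -/
def IsSparseNodeSet (c a : ℕ) (S : Finset ℂ) : Prop :=
  S.card = a + 1 ∧ ∃ q : Polynomial ℂ, q.natDegree + c ≤ a ∧ ∀ s ∈ S, s ^ (a + 1) = q.eval s

/-- The Lagrange weights extract the coefficient of `t ^ a` from polynomials of degree at most `a`.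
Sparsity extends this to `c` further powers: on `S` these agree with polynomials of degree less than
`a`. -/
theorem IsSparseNodeSet.exists_weights {c a : ℕ} {S : Finset ℂ} (hS : IsSparseNodeSet c a S) :
    ∃ w : ℂ → ℂ, ∀ k ≤ a + c, ∑ s ∈ S, w s * s ^ k = if k = a then 1 else 0 := by
  obtain ⟨hcard, q, hq, hroot⟩ := hS
  have key (f : Polynomial ℂ) (hf : f.natDegree ≤ a) :
      ∑ s ∈ S, (∏ j ∈ S.erase s, (s - j))⁻¹ * f.eval s = f.coeff a := by
    have hdeg : f.degree < S.card := by
      rw [hcard]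
      exact lt_of_le_of_lt Polynomial.degree_le_natDegree (by exact_mod_cast Nat.lt_succ_of_le hf)
    have := Lagrange.coeff_eq_sum (s := S) (v := id) Function.injective_id.injOn hdeg
    rw [hcard, Nat.add_sub_cancel] at this
    rw [this]
    exact Finset.sum_congr rfl fun s _ => by rw [div_eq_inv_mul]; rfl
  refine ⟨fun s => (∏ j ∈ S.erase s, (s - j))⁻¹, fun k hk => ?_⟩
  rcases Nat.lt_or_ge a k with h | h
  -- Here `k = a + 1 + d`, so `d ≤ c - 1` and `q * X ^ d` has degree at most `a - 1`.
  · obtain ⟨d, rfl⟩ := Nat.exists_eq_add_of_le h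
    have hdeg : (q * Polynomial.X ^ d).natDegree < a := by
      have := Polynomial.natDegree_mul_le (p := q) (q := Polynomial.X ^ d)
      rw [Polynomial.natDegree_X_pow] at this
      omega
    have := key (q * Polynomial.X ^ d) hdeg.le
    rw [Polynomial.coeff_eq_zero_of_natDegree_lt hdeg] at this
    rw [if_neg (by omega), ← this]
    refine Finset.sum_congr rfl fun s hs => ?_
    simp [pow_add, ← hroot s hs]
  · have := key (Polynomial.X ^ k) (by simpa using h)
    simpa [Polynomial.coeff_X_pow, eq_comm] using this

/-- The linear form `x₀ + p₁ x₁ + ⋯ + pₙ xₙ`. -/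
noncomputable def gridForm {n : ℕ} (p : Fin n → ℂ) : MvPolynomial (Fin (n + 1)) ℂ :=
  ∑ i, (Fin.cons 1 p : Fin (n + 1) → ℂ) i • X i

/-- With product weights, each coefficient factors into one-variable moments. If none vanishes,
every `mᵢ ≥ aᵢ`; equality of degrees then gives `mᵢ ≤ aᵢ + c`, the range in which only `mᵢ = aᵢ`
survives. -/
theorem exists_powerMonomial_eq_sum_grid {n c : ℕ} {a : Fin n → ℕ} {S : Fin n → Finset ℂ}
    (hS : ∀ i, IsSparseNodeSet c (a i) (S i)) {P : Finset (Fin n → ℂ)}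
    (hP : Fintype.piFinset S ⊆ P) :
    ∃ lam : (Fin n → ℂ) → ℂ, powerMonomial c a =
      ∑ p ∈ P, C (lam p) * gridForm p ^ (powerMonomial c a).totalDegree := by
  classical
  choose w hw using fun i => (hS i).exists_weights
  have hmult : ((powerExponent c a).multinomial : ℂ) ≠ 0 :=
    Nat.cast_ne_zero.2 (Finsupp.multinomial_ne_zero _)
  suffices h : ∃ lam : (Fin n → ℂ) → ℂ, powerMonomial c a = ∑ p ∈ Fintype.piFinset S,
      C (lam p) * gridForm p ^ (powerMonomial c a).totalDegree by
    obtain ⟨lam, h⟩ := h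
    refine ⟨fun p => if p ∈ Fintype.piFinset S then lam p else 0, ?_⟩
    rw [← Finset.sum_subset hP fun p _ hp => by simp only [if_neg hp, C_0, zero_mul]]
    exact h.trans (Finset.sum_congr rfl fun p hp => by simp only [if_pos hp])
  refine ⟨fun p => ((powerExponent c a).multinomial : ℂ)⁻¹ * ∏ i, w i (p i), ?_⟩
  rw [totalDegree_powerMonomial, powerMonomial_eq_monomial]
  refine (monomial_eq_sum_pow_iff _ (fun p => Fin.cons 1 p) _ _).2 fun m hm => ?_
  have hsum : ∑ p ∈ Fintype.piFinset S, ((powerExponent c a).multinomial : ℂ)⁻¹ *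
      (∏ i, w i (p i)) * ∏ i, (Fin.cons 1 p : Fin (n + 1) → ℂ) i ^ m i =
      ((powerExponent c a).multinomial : ℂ)⁻¹ *
        ∏ i, ∑ s ∈ S i, w i s * s ^ m i.succ := by
    rw [Finset.prod_univ_sum, Finset.mul_sum]
    refine Finset.sum_congr rfl fun p _ => ?_
    simp [Fin.prod_univ_succ, Finset.prod_mul_distrib, mul_assoc]
  rw [hsum]
  split_ifs with h
  · subst h
    rw [Finset.prod_eq_one, mul_one, mul_inv_cancel₀ hmult]
    intro i _
    rw [hw i _ (by simp), if_pos (by simp)]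
  · have hdeg : m 0 + ∑ i : Fin n, m i.succ = c + ∑ i, a i := by
      rw [← degree_powerExponent c a, ← hm, Finsupp.degree_eq_sum, Fin.sum_univ_succ]
    suffices hzero : ∏ i, ∑ s ∈ S i, w i s * s ^ m i.succ = 0 by simp [hzero]
    by_contra hne
    rw [← ne_eq, Finset.prod_ne_zero_iff] at hne
    have hle (i : Fin n) : a i ≤ m i.succ := by
      by_contra hlt
      exact hne i (Finset.mem_univ i) (by rw [hw i _ (by omega), if_neg (by omega)])
    have hub (i : Fin n) : m i.succ + ∑ j, a j ≤ a i + ∑ j : Fin n, m j.succ := by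
      rw [← Finset.add_sum_erase _ a (Finset.mem_univ i),
        ← Finset.add_sum_erase _ (fun j : Fin n => m j.succ) (Finset.mem_univ i)]
      have := Finset.sum_le_sum fun j (_ : j ∈ Finset.univ.erase i) => hle j
      omega
    have heq (i : Fin n) : m i.succ = a i := by
      by_contra hlt
      refine hne i (Finset.mem_univ i) ?_
      have := hub i
      rw [hw i _ (by omega), if_neg hlt]
    simp only [heq, add_left_inj] at hdeg
    apply h
    rw [← powerExponent_self m]
    simp only [heq, hdeg]

/-! ### Lower bound for the rank of a monomial. -/

theorem prod_succ_le_of_hasSimultaneousWaringDecomposition {n c r : ℕ} {a : Fin n → ℕ} (hc : 1 ≤ c)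
    (h : HasSimultaneousWaringDecomposition {powerMonomial c a} r) : ∏ i, (a i + 1) ≤ r := by
  classical
  obtain ⟨L, hL, h⟩ := h
  obtain ⟨lam, hlam⟩ := h _ rfl
  choose p hp using fun j => (hL j).eq_sum_smul_X
  rw [totalDegree_powerMonomial, powerMonomial_eq_monomial] at hlam
  simp only [hp] at hlam
  have hmom := (monomial_eq_sum_pow_iff _ p _ _).1 hlam
  -- Evaluations of the `∏ (aᵢ + 1)` monomials `y ^ e`, `eᵢ ≤ aᵢ`, at the points with `x₀ ≠ 0`;
  -- their independence in `ℂ ^ r` gives the bound.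
  let v : (∀ i, Fin (a i + 1)) → Fin r → ℂ :=
    fun e j => if p j 0 = 0 then 0 else ∏ i, (p j i.succ / p j 0) ^ (e i : ℕ)
  suffices hv : LinearIndependent ℂ v by simpa using hv.fintype_card_le_finrank
  rw [Fintype.linearIndependent_iff]
  intro g hg
  by_contra! hne
  obtain ⟨e₁, he₁⟩ := hne
  obtain ⟨e, he, hmax⟩ := (Finset.univ.filter fun e => g e ≠ 0).exists_max_image
    (fun e => ∑ i, (e i : ℕ)) ⟨e₁, by simpa using he₁⟩
  simp only [Finset.mem_filter, Finset.mem_univ, true_and] at he hmax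
  -- With `e` of maximal degree in the relation, multiplying by `x₀ ^ (c + |e|) * ∏ xᵢ ^ (aᵢ - eᵢ)`
  -- turns each `y ^ f` into a monomial of the degree of `powerMonomial c a`, equal to it only for
  -- `f = e`.
  let m : (∀ i, Fin (a i + 1)) → Fin (n + 1) →₀ ℕ := fun f =>
    powerExponent (c + ∑ i, (e i : ℕ) - ∑ i, (f i : ℕ)) fun i => a i - e i + f i
  have hea (i : Fin n) : (e i : ℕ) ≤ a i := Nat.le_of_lt_succ (e i).2
  have hsum : ∑ i, (a i - e i) + ∑ i, (e i : ℕ) = ∑ i, a i := by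
    rw [← Finset.sum_add_distrib]
    exact Finset.sum_congr rfl fun i _ => Nat.sub_add_cancel (hea i)
  have hterm (f) (hf : g f ≠ 0) (j : Fin r) : ∏ i, p j i ^ m f i =
      (p j 0 ^ (c + ∑ i, (e i : ℕ)) * ∏ i, p j i.succ ^ (a i - e i)) * v f j := by
    have hfe := hmax f hf
    rw [Fin.prod_univ_succ]
    simp only [m, powerExponent_zero, powerExponent_succ, v]
    split_ifs with h0
    -- The exponent of `x₀` is at least `c ≥ 1`, so points with `x₀ = 0` contribute nothing.
    · rw [h0, zero_pow (by omega)]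
      simp
    · have : p j 0 ^ (c + ∑ i, (e i : ℕ)) =
          p j 0 ^ (c + ∑ i, (e i : ℕ) - ∑ i, (f i : ℕ)) * ∏ i, p j 0 ^ (f i : ℕ) := by
        rw [Finset.prod_pow_eq_pow_sum, ← pow_add, Nat.sub_add_cancel (by omega)]
      rw [this, mul_assoc, mul_assoc]
      congr 1
      rw [← Finset.prod_mul_distrib, ← Finset.prod_mul_distrib]
      refine Finset.prod_congr rfl fun i _ => ?_
      rw [pow_add, div_pow]
      field_simp
  have hdegm (f) (hf : g f ≠ 0) : (m f).degree = (powerExponent c a).degree := by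
    have hfe := hmax f hf
    simp only [m, degree_powerExponent, Finset.sum_add_distrib]
    omega
  have hzero : ∑ f, g f * ∑ j, lam j * ∏ i, p j i ^ m f i = 0 := by
    have : ∀ f, g f * ∑ j, lam j * ∏ i, p j i ^ m f i = ∑ j, lam j *
        (p j 0 ^ (c + ∑ i, (e i : ℕ)) * ∏ i, p j i.succ ^ (a i - e i)) * (g f * v f j) := by
      intro f
      by_cases hf : g f = 0
      · simp [hf]
      · rw [Finset.mul_sum]
        refine Finset.sum_congr rfl fun j _ => ?_
        rw [hterm f hf]
        ring
    simp only [this]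
    rw [Finset.sum_comm]
    refine Finset.sum_eq_zero fun j _ => ?_
    have hgj := congrFun hg j
    simp only [Finset.sum_apply, Pi.smul_apply, smul_eq_mul, Pi.zero_apply] at hgj
    rw [← Finset.mul_sum, hgj, mul_zero]
  have hme : m e = powerExponent c a := by
    simp only [m, Nat.add_sub_cancel, Nat.sub_add_cancel (hea _)]
  rw [Finset.sum_eq_single_of_mem e (Finset.mem_univ e)] at hzero
  · have h1 := hmom (m e) (hdegm e he)
    rw [(mul_eq_zero.1 hzero).resolve_left he, mul_zero, if_pos hme] at h1
    exact zero_ne_one h1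
  · intro f _ hfe
    by_cases hf : g f = 0
    · rw [hf, zero_mul]
    have h1 := hmom (m f) (hdegm f hf)
    rw [if_neg] at h1
    · rw [(mul_eq_zero.1 h1).resolve_left (Nat.cast_ne_zero.2 (Finsupp.multinomial_ne_zero _)),
        mul_zero]
    · intro h2
      apply hfe
      ext i
      have h3 := DFunLike.congr_fun h2 i.succ
      simp only [m, powerExponent_succ] at h3
      have := hea i
      omega

/-! ### Nested node sets and conclusion. -/

theorem exists_finset_pow_eq {k : ℕ} (hk : 0 < k) {z : ℂ} (hz : z ≠ 0) :
    ∃ S : Finset ℂ, S.card = k ∧ ∀ x, x ∈ S ↔ x ^ k = z := by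
  classical
  have hsep := Polynomial.separable_X_pow_sub_C z (n := k) (by exact_mod_cast hk.ne') hz
  have hnodup : (Polynomial.nthRoots k z).Nodup := Polynomial.nodup_roots hsep
  refine ⟨(Polynomial.nthRoots k z).toFinset, ?_, fun x => ?_⟩
  · rw [Multiset.toFinset_card_of_nodup hnodup, Polynomial.nthRoots,
      IsAlgClosed.card_roots_eq_natDegree, Polynomial.natDegree_X_pow_sub_C]
  · rw [Multiset.mem_toFinset, Polynomial.mem_nthRoots hk]

/-- The smaller nodal polynomial is `t ^ (a + 1) - 1`; the larger one multiplies it by `1`, `t` or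
`t ^ (b - a) - 2`. -/
theorem exists_nested_sparseNodeSets {c a b : ℕ} (ha : c ≤ a) (hab : a ≤ b)
    (h : b = a ∨ b = a + 1 ∨ c + 1 ≤ b - a) :
    ∃ S T : Finset ℂ, IsSparseNodeSet c a S ∧ IsSparseNodeSet c b T ∧ S ⊆ T := by
  classical
  obtain ⟨S, hcard, hmem⟩ := exists_finset_pow_eq a.succ_pos (one_ne_zero (α := ℂ))
  have hS : IsSparseNodeSet c a S := ⟨hcard, 1, by simpa, fun s hs => by simp [(hmem s).1 hs]⟩
  rcases h with rfl | rfl | h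
  · exact ⟨S, S, hS, hS, subset_rfl⟩
  · refine ⟨S, insert 0 S, hS, ⟨?_, Polynomial.X, by simp; omega, ?_⟩, Finset.subset_insert _ _⟩
    · rw [Finset.card_insert_of_notMem, hcard]
      simp [hmem]
    · intro s hs
      rcases Finset.mem_insert.1 hs with rfl | hs
      · simp
      · simp [pow_succ s (a + 1), (hmem s).1 hs]
  -- The constant `2` keeps the new roots off the unit circle. The lower terms have degrees at most
  -- `b - a` and `a + 1`, both at most `b - c` because `c ≤ a` and `c + 1 ≤ b - a`.
  · obtain ⟨U, hUcard, hUmem⟩ := exists_finset_pow_eq (k := b - a) (by omega)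
      (two_ne_zero (α := ℂ))
    refine ⟨S, S ∪ U, hS, ⟨?_, Polynomial.X ^ (b - a) + 2 * Polynomial.X ^ (a + 1) - 2, ?_, ?_⟩,
      Finset.subset_union_left⟩
    · rw [Finset.card_union_of_disjoint, hcard, hUcard]
      · omega
      · rw [Finset.disjoint_left]
        intro s hs hu
        have h1 := congrArg norm ((hmem s).1 hs)
        have h2 := congrArg norm ((hUmem s).1 hu)
        rw [norm_pow, norm_one, pow_eq_one_iff_of_nonneg (norm_nonneg s) a.succ_ne_zero] at h1
        rw [norm_pow, h1] at h2
        norm_num at h2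
    · have : (Polynomial.X ^ (b - a) + 2 * Polynomial.X ^ (a + 1) - 2 :
          Polynomial ℂ).natDegree ≤ max (b - a) (a + 1) := by compute_degree!
      omega
    · intro s hs
      have hb : b + 1 = (b - a) + (a + 1) := by omega
      rw [hb, pow_add]
      simp only [Polynomial.eval_sub, Polynomial.eval_add, Polynomial.eval_mul,
        Polynomial.eval_pow, Polynomial.eval_X, Polynomial.eval_ofNat]
      rcases Finset.mem_union.1 hs with hs | hs
      · rw [(hmem s).1 hs]; ring
      · rw [(hUmem s).1 hs]; ring

theorem exists_sparseNodeSets_inter {c a b : ℕ} (ha : c ≤ a) (hb : c ≤ b)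
    (hab : |(a : ℤ) - b| = 0 ∨ |(a : ℤ) - b| = 1 ∨ (c : ℤ) + 1 ≤ |(a : ℤ) - b|) :
    ∃ S T : Finset ℂ, IsSparseNodeSet c a S ∧ IsSparseNodeSet c b T ∧
      IsSparseNodeSet c (min a b) (S ∩ T) := by
  rcases le_total a b with h | h
  · rw [abs_of_nonpos (by omega)] at hab
    obtain ⟨S, T, hS, hT, hST⟩ := exists_nested_sparseNodeSets ha h (by omega)
    exact ⟨S, T, hS, hT, by rwa [min_eq_left h, Finset.inter_eq_left.2 hST]⟩
  · rw [abs_of_nonneg (by omega)] at hab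
    obtain ⟨S, T, hS, hT, hST⟩ := exists_nested_sparseNodeSets hb h (by omega)
    exact ⟨T, S, hT, hS, by rwa [min_eq_right h, Finset.inter_eq_right.2 hST]⟩

theorem IsSparseNodeSet.card_piFinset {n c : ℕ} {a : Fin n → ℕ} {S : Fin n → Finset ℂ}
    (hS : ∀ i, IsSparseNodeSet c (a i) (S i)) : (Fintype.piFinset S).card = ∏ i, (a i + 1) := by
  rw [Fintype.card_piFinset]
  exact Finset.prod_congr rfl fun i _ => (hS i).1

theorem hasSimultaneousWaringDecomposition_powerMonomial {n c : ℕ} {a : Fin n → ℕ}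
    {S : Fin n → Finset ℂ} (hS : ∀ i, IsSparseNodeSet c (a i) (S i)) :
    HasSimultaneousWaringDecomposition {powerMonomial c a} (∏ i, (a i + 1)) := by
  rw [← IsSparseNodeSet.card_piFinset hS]
  refine .of_finset _ gridForm (fun p _ => isHomogeneous_sum_smul_X _) fun F hF => ?_
  rw [Set.mem_singleton_iff.1 hF]
  exact exists_powerMonomial_eq_sum_grid hS subset_rfl

theorem mainTheorem7 (n c : ℕ) (a b : Fin n → ℕ) (hc : 1 ≤ c)
    (ha : ∀ i, c ≤ a i) (hb : ∀ i, c ≤ b i)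
    (hab : ∀ i, |(a i : ℤ) - b i| = 0 ∨ |(a i : ℤ) - b i| = 1 ∨ (c : ℤ) + 1 ≤ |(a i : ℤ) - b i|)
    (M₁₂ : MvPolynomial (Fin (n + 1)) ℂ)
    (hM₁₂ : IsGreatestCommonDivisor M₁₂ (powerMonomial c a) (powerMonomial c b)) :
    ∃ r r₁ r₂ r₁₂ : ℕ,
      simultaneousWaringRank {powerMonomial c a, powerMonomial c b} = (r : ℕ∞) ∧
      waringRank (powerMonomial c a) = (r₁ : ℕ∞) ∧
      waringRank (powerMonomial c b) = (r₂ : ℕ∞) ∧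
      waringRank M₁₂ = (r₁₂ : ℕ∞) ∧
      (r : ℤ) ≤ r₁ + r₂ - r₁₂ := by
  classical
  choose S T hS hT hST using fun i => exists_sparseNodeSets_inter (ha i) (hb i) (hab i)
  obtain ⟨u, hu, rfl⟩ := isGreatestCommonDivisor_powerMonomial hM₁₂
  have hunion : HasSimultaneousWaringDecomposition {powerMonomial c a, powerMonomial c b}
      (Fintype.piFinset S ∪ Fintype.piFinset T).card := by
    refine .of_finset _ gridForm (fun p _ => isHomogeneous_sum_smul_X _) fun F hF => ?_
    rcases hF with rfl | rfl
    · exact exists_powerMonomial_eq_sum_grid hS Finset.subset_union_left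
    · exact exists_powerMonomial_eq_sum_grid hT Finset.subset_union_right
  have hcard := Finset.card_union_add_card_inter (Fintype.piFinset S) (Fintype.piFinset T)
  rw [← Fintype.piFinset_inter, IsSparseNodeSet.card_piFinset hS, IsSparseNodeSet.card_piFinset hT,
    IsSparseNodeSet.card_piFinset hST] at hcard
  obtain ⟨r, hr, hr_le, -⟩ := exists_simultaneousWaringRank_eq hunion
  obtain ⟨r₁, hr₁, -, hdec₁⟩ :=
    exists_simultaneousWaringRank_eq (hasSimultaneousWaringDecomposition_powerMonomial hS)
  obtain ⟨r₂, hr₂, -, hdec₂⟩ :=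
    exists_simultaneousWaringRank_eq (hasSimultaneousWaringDecomposition_powerMonomial hT)
  obtain ⟨r₁₂, hr₁₂, hr₁₂_le, -⟩ :=
    exists_simultaneousWaringRank_eq ((hasSimultaneousWaringDecomposition_powerMonomial hST).C_mul hu)
  have h₁ := prod_succ_le_of_hasSimultaneousWaringDecomposition hc hdec₁
  have h₂ := prod_succ_le_of_hasSimultaneousWaringDecomposition hc hdec₂
  exact ⟨r, r₁, r₂, r₁₂, hr, hr₁, hr₂, hr₁₂, by omega⟩
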